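/- Let $n\ge 1$, $N=\{1,\dots,n\}$, and let $\nu:2^N\to[0,1]$ be a game, i.e. $\nu(\varnothing)=0$. For a permutation $\sigma\in\mathfrak S_n$ put $\nu_i^\sigma:=\nu(\{\sigma(1),\dots,\sigma(i)\})$, $i=0,\dots,n$ (so $\nu_0^\sigma=0$). The discrete Choquet integral of $\mathbf x\in\mathbb R^n$ is $C_\nu(\mathbf x):=\sum_{i=1}^n(\nu_i^\sigma-\nu_{i-1}^\sigma)\,x_{\sigma(i)}$ for any $\sigma$ with $x_{\sigma(1)}\ge\dots\ge x_{\sigma(n)}$ (the value does not depend on the choice of $\sigma$). Let $U_1,\dots,U_n$ be independent random variables, each uniform on $[0,1]$, let $Y_\nu:=C_\nu(U_1,\dots,U_n)$, and let $F_\nu(y):=\mathbf P(Y_\nu\le y)$. For $m\ge0$ let $x_+^m$ (resp. $x_-^m$) be $x^m$ if $x>0$ (resp. $x<0$) and $0$ otherwise. Let $\Delta[g:a_0,\dots,a_n]$ be the divided difference, defined by $\Delta[g:a_0]:=g(a_0)$ and, for $n\ge1$, $\Delta[g:a_0,\dots,a_n]:=\dfrac{\Delta[g:a_1,\dots,a_n]-\Delta[g:a_0,\dots,a_{n-1}]}{a_n-a_0}$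 if $a_0\ne a_n$ and $:=\dfrac{\partial}{\partial a_0}\Delta[g:a_0,\dots,a_{n-1}]$ if $a_0=a_n$. Let $M(t\mid a_0,\dots,a_n):=n\,\Delta[(\cdot-t)_+^{n-1}:a_0,\dots,a_n]$ be the B-spline with knots $a_0,\dots,a_n$. Say that $\nu$ is nondegenerate if for every $\sigma\in\mathfrak S_n$ some $\nu_i^\sigma$ is nonzero (for instance, if $\nu(N)=1$). Theorem 1. (a) For every $y\in\mathbb R$, with $y\neq0$ if $\nu$ is not nondegenerate, $$F_\nu(y)=\frac1{n!}\sum_{\sigma\in\mathfrak S_n}\Delta[(\cdot-y)_-^n:\nu_0^\sigma,\dots,\nu_n^\sigma]=1-\frac1{n!}\sum_{\sigma\in\mathfrak S_n}\Delta[(\cdot-y)_+^n:\nu_0^\sigma,\dots,\nu_n^\sigma].$$ (b) If $\nu$ is nondegenerate, then $Y_\nu$ has a probability density function (with respect to Lebesgue measure), given for almost every $y$ by $$f_\nu(y)=\frac1{n!}\sum_{\sigma\in\mathfrak S_n}M(y\mid\nu_0^\sigma,\dots,\nu_n^\sigma).$$ -/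

import Mathlib

open MeasureTheory ProbabilityTheory

noncomputable section

/-- A game on `N = Fin n`: a set function with values in `[0, 1]` that vanishes at `∅`. -/
def IsGame {n : ℕ} (ν : Finset (Fin n) → ℝ) : Prop :=
  ν ∅ = 0 ∧ ∀ S, ν S ∈ Set.Icc (0 : ℝ) 1

/-- The set `{σ(1), …, σ(i)}` of the images under `σ` of the first `i` elements. -/
def prefixSet {n : ℕ} (σ : Equiv.Perm (Fin n)) (i : ℕ) : Finset (Fin n) :=
  (Finset.univ.filter (fun k : Fin n => (k : ℕ) < i)).map σ.toEmbedding

/-- The cumulative values `ν_i^σ = ν({σ(1), …, σ(i)})`, for `i = 0, …, n`. -/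
def cumul {n : ℕ} (ν : Finset (Fin n) → ℝ) (σ : Equiv.Perm (Fin n)) (i : Fin (n + 1)) : ℝ :=
  ν (prefixSet σ i)

/-- The linear form `∑ p_i^{ν,σ} x_{σ(i)}`, where `p_i^{ν,σ} = ν_i^σ - ν_{i-1}^σ`. -/
def choquetAlong {n : ℕ} (ν : Finset (Fin n) → ℝ) (σ : Equiv.Perm (Fin n)) (x : Fin n → ℝ) : ℝ :=
  ∑ i : Fin n, (cumul ν σ i.succ - cumul ν σ i.castSucc) * x (σ i)

/-- The discrete Choquet integral of `x` with respect to `ν`, computed along a permutation that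
sorts `x` in nonincreasing order; by `choquet_eq` any such permutation gives the same value. -/
def choquet {n : ℕ} (ν : Finset (Fin n) → ℝ) (x : Fin n → ℝ) : ℝ :=
  choquetAlong ν (Tuple.sort (fun i => OrderDual.toDual (x i))) x

theorem mem_prefixSet {n : ℕ} (σ : Equiv.Perm (Fin n)) (i : ℕ) (j : Fin n) :
    j ∈ prefixSet σ i ↔ ((σ.symm j : Fin n) : ℕ) < i := by
  simp only [prefixSet, Finset.mem_map, Finset.mem_filter, Finset.mem_univ, true_and,
    Equiv.coe_toEmbedding]
  constructor
  · rintro ⟨k, hk, rfl⟩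
    simpa using hk
  · intro h
    exact ⟨σ.symm j, h, by simp⟩

theorem prefixSet_eq_of_lt {n : ℕ} (σ : Equiv.Perm (Fin n)) (x : Fin n → ℝ)
    (hσ : Antitone (x ∘ σ)) (m : ℕ) (hm : m + 1 < n)
    (hz : x (σ ⟨m + 1, hm⟩) < x (σ ⟨m, by omega⟩)) :
    prefixSet σ (m + 1) = Finset.univ.filter (fun j => x (σ ⟨m, by omega⟩) ≤ x j) := by
  ext j
  rw [mem_prefixSet, Finset.mem_filter]
  simp only [Finset.mem_univ, true_and]
  constructor
  · intro h
    have h1 := hσ (show σ.symm j ≤ ⟨m, by omega⟩ from Fin.le_def.2 (Nat.le_of_lt_succ h))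
    simpa using h1
  · intro h
    by_contra hc
    have h1 := hσ (show (⟨m + 1, hm⟩ : Fin n) ≤ σ.symm j from Fin.le_def.2 (Nat.le_of_not_lt hc))
    simp only [Function.comp_apply, Equiv.apply_symm_apply] at h1
    linarith

theorem choquetAlong_eq {n : ℕ} (ν : Finset (Fin n) → ℝ) (x : Fin n → ℝ)
    (σ τ : Equiv.Perm (Fin n)) (hσ : Antitone (x ∘ σ)) (hτ : Antitone (x ∘ τ)) :
    choquetAlong ν σ x = choquetAlong ν τ x := by
  have hz : x ∘ σ = x ∘ τ := Tuple.unique_antitone hσ hτ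
  have hz' : ∀ i, x (σ i) = x (τ i) := fun i => congrFun hz i
  let D : ℕ → ℝ := fun m => ν (prefixSet σ m) - ν (prefixSet τ m)
  let z : ℕ → ℝ := fun m => if h : m < n then x (σ ⟨m, h⟩) else 0
  have hD0 : D 0 = 0 := by simp [D, prefixSet]
  have hDn : D n = 0 := by
    have h1 : prefixSet σ n = prefixSet τ n := by
      ext j
      simp [mem_prefixSet]
    simp [D, h1]
  have key : ∀ m, m < n → D (m + 1) * z m = D (m + 1) * z (m + 1) := by
    intro m hm
    rcases Nat.lt_or_ge (m + 1) n with h | h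
    · by_cases he : x (σ ⟨m + 1, h⟩) = x (σ ⟨m, hm⟩)
      · simp [z, h, hm, he]
      · have hl : x (σ ⟨m + 1, h⟩) < x (σ ⟨m, hm⟩) :=
          lt_of_le_of_ne (hσ (show (⟨m, hm⟩ : Fin n) ≤ ⟨m + 1, h⟩ from Fin.mk_le_mk.2 (by omega))) he
        have h1 := prefixSet_eq_of_lt σ x hσ m h hl
        have h2 := prefixSet_eq_of_lt τ x hτ m h (by rw [← hz', ← hz']; exact hl)
        have h3 : D (m + 1) = 0 := by
          simp only [D]
          rw [h1, h2, hz', sub_self]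
        rw [h3, zero_mul, zero_mul]
    · have h3 : m + 1 = n := by omega
      rw [h3, hDn, zero_mul, zero_mul]
  have tel : ∀ m, m ≤ n → ∑ i ∈ Finset.range m, (D (i + 1) - D i) * z i = D m * z m := by
    intro m
    induction m with
    | zero => intro _; simp [hD0]
    | succ m ih =>
      intro hm
      rw [Finset.sum_range_succ, ih (by omega), ← key m (by omega)]
      ring
  have h0 := tel n le_rfl
  rw [hDn, zero_mul, Finset.sum_range] at h0
  rw [← sub_eq_zero, choquetAlong, choquetAlong, ← Finset.sum_sub_distrib, ← h0]
  refine Finset.sum_congr rfl fun i _ => ?_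
  simp only [D, z, cumul, Fin.val_succ, Fin.val_castSucc, i.isLt, dite_true, Fin.eta, ← hz' i]
  ring

theorem choquet_eq {n : ℕ} (ν : Finset (Fin n) → ℝ) (x : Fin n → ℝ)
    (σ : Equiv.Perm (Fin n)) (hσ : Antitone (x ∘ σ)) :
    choquet ν x = choquetAlong ν σ x := by
  refine choquetAlong_eq ν x _ _ ?_ hσ
  intro i j hij
  exact Tuple.monotone_sort (fun i => OrderDual.toDual (x i)) hij

/-- The `n`th divided difference `Δ[g : a_0, …, a_n]`. -/
def divDiff (g : ℝ → ℝ) : (n : ℕ) → (Fin (n + 1) → ℝ) → ℝ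
  | 0, a => g (a 0)
  | n + 1, a =>
    open Classical in
    if a 0 ≠ a (Fin.last (n + 1)) then
      (divDiff g n (Fin.tail a) - divDiff g n (Fin.init a)) / (a (Fin.last (n + 1)) - a 0)
    else
      deriv (fun t : ℝ => divDiff g n (Function.update (Fin.init a) 0 t)) (a 0)

/-- The plus truncated power `x_+^n`: `x ^ n` if `x > 0` and `0` otherwise (also for `n = 0`). -/
def truncPlus (n : ℕ) (x : ℝ) : ℝ := open Classical in if 0 < x then x ^ n else 0

/-- The minus truncated power `x_-^n`: `x ^ n` if `x < 0` and `0` otherwise (also for `n = 0`). -/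
def truncMinus (n : ℕ) (x : ℝ) : ℝ := open Classical in if x < 0 then x ^ n else 0

/-- The B-spline `M(t | a_0, …, a_n) = n Δ[(· - t)_+^{n-1} : a_0, …, a_n]` of order `n`, `n ≥ 1`. -/
def bSpline (n : ℕ) (a : Fin (n + 1) → ℝ) (t : ℝ) : ℝ :=
  n * divDiff (fun x => truncPlus (n - 1) (x - t)) n a

end

/-! Cut the unit cube into the `n!` chambers on which a fixed permutation `σ` sorts the coordinates
in nonincreasing order; they overlap only in null sets. On a chamber take as new coordinates the
gaps `w_i` between consecutive sorted values, the last gap being the smallest value itself. This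
change of variables is unimodular and identifies the chamber with the solid simplex
(`chamberMap_preimage_chamber`). By summation by parts the Choquet integral becomes the barycentric
combination of the knots `ν_0^σ, …, ν_n^σ` with weights `1 - ∑ w_i, w_1, …, w_n`
(`choquetAlong_chamberMap`). Hence the law of `Y_ν` gives `A` the sum over `σ` of the volumes of the
weights whose barycentric point lies in `A` (`map_choquet_apply`).

The Hermite–Genocchi formula writes a divided difference of order `n` as the integral of the `n`-th
derivative over these barycentric points. For a truncated power of degree `n` that derivative is
`n!` times the indicator of a half-line, so the divided difference is `n!` times one of the volumes
above. The derivative is missing at `y`, which is harmless unless all knots equal `y`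
(`divDiff_succ_eq_simplexIntegral`). As `ν_0^σ = 0`, this is what the hypothesis of (a) excludes.

For (b), a nonconstant affine form pulls null sets back to null sets, so the law is absolutely
continuous. Away from the knots the formula of (a) can be differentiated in `y` and yields the
B-splines (`hasDerivAt_divDiff_truncPlus`). An almost everywhere derivative of the distribution
function of such a law is its density. -/

noncomputable section

/-! ### Integration over the solid simplex -/

/-- The solid simplex of the nonnegative weights with sum at most `1`. -/
def solidSimplex (m : ℕ) : Set (Fin m → ℝ) := {w | (∀ i, 0 ≤ w i) ∧ ∑ i, w i ≤ 1}

/-- The point of the line with weights `1 - ∑ w_i, w_1, …, w_m` with respect to `b_0, …, b_m`. -/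
def baryPoint {m : ℕ} (b : Fin (m + 1) → ℝ) (w : Fin m → ℝ) : ℝ :=
  b 0 + ∑ i, w i * (b i.succ - b 0)

/-- The integral of `h` over the solid simplex, along the barycentric combinations of the knots. -/
def simplexIntegral {m : ℕ} (h : ℝ → ℝ) (b : Fin (m + 1) → ℝ) : ℝ :=
  ∫ w in solidSimplex m, h (baryPoint b w)

/-- `h` is bounded on every bounded set. -/
def LocallyBdd (h : ℝ → ℝ) : Prop := ∀ R : ℝ, ∃ C : ℝ, ∀ x, |x| ≤ R → |h x| ≤ C

theorem Continuous.locallyBdd {h : ℝ → ℝ} (hh : Continuous h) : LocallyBdd h := by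
  intro R
  obtain ⟨C, hC⟩ := (isCompact_Icc (a := -R) (b := R)).exists_bound_of_continuousOn hh.continuousOn
  exact ⟨C, fun x hx => by simpa using hC x (abs_le.1 hx)⟩

theorem isClosed_solidSimplex (m : ℕ) : IsClosed (solidSimplex m) := by
  have : solidSimplex m = (⋂ i, {w : Fin m → ℝ | 0 ≤ w i}) ∩ {w | ∑ i, w i ≤ 1} := by
    ext w; simp [solidSimplex]
  rw [this]
  refine (isClosed_iInter fun i => isClosed_le continuous_const (continuous_apply i)).inter
    (isClosed_le (by fun_prop) continuous_const)

theorem solidSimplex_subset (m : ℕ) : solidSimplex m ⊆ Set.Icc 0 1 := by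
  intro w hw
  refine ⟨fun i => hw.1 i, fun i => ?_⟩
  exact (Finset.single_le_sum (fun j _ => hw.1 j) (Finset.mem_univ i)).trans hw.2

theorem isCompact_solidSimplex (m : ℕ) : IsCompact (solidSimplex m) :=
  isCompact_Icc.of_isClosed_subset (isClosed_solidSimplex m) (solidSimplex_subset m)

theorem measurableSet_solidSimplex (m : ℕ) : MeasurableSet (solidSimplex m) :=
  (isClosed_solidSimplex m).measurableSet

theorem volume_solidSimplex_ne_top (m : ℕ) : volume (solidSimplex m) ≠ ⊤ :=
  (isCompact_solidSimplex m).measure_lt_top.ne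

instance (m : ℕ) : IsFiniteMeasure (volume.restrict (solidSimplex m)) :=
  ⟨by simpa using (isCompact_solidSimplex m).measure_lt_top⟩

theorem continuous_baryPoint {m : ℕ} (b : Fin (m + 1) → ℝ) : Continuous (baryPoint b) := by
  unfold baryPoint; fun_prop

theorem baryPoint_eq {m : ℕ} (b : Fin (m + 1) → ℝ) (w : Fin m → ℝ) :
    baryPoint b w = (1 - ∑ i, w i) * b 0 + ∑ i, w i * b i.succ := by
  simp only [baryPoint, mul_sub, Finset.sum_sub_distrib, ← Finset.sum_mul]
  ring

theorem abs_baryPoint_le {m : ℕ} (b : Fin (m + 1) → ℝ) {R : ℝ} (hR : ∀ i, |b i| ≤ R)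
    {w : Fin m → ℝ} (hw : w ∈ solidSimplex m) : |baryPoint b w| ≤ R := by
  rw [baryPoint_eq]
  have h1 : |∑ i, w i * b i.succ| ≤ (∑ i, w i) * R := by
    rw [Finset.sum_mul]
    refine (Finset.abs_sum_le_sum_abs _ _).trans (Finset.sum_le_sum fun i _ => ?_)
    rw [abs_mul, abs_of_nonneg (hw.1 i)]
    exact mul_le_mul_of_nonneg_left (hR _) (hw.1 i)
  have h2 : |(1 - ∑ i, w i) * b 0| ≤ (1 - ∑ i, w i) * R := by
    have h3 : 0 ≤ 1 - ∑ i, w i := sub_nonneg.2 hw.2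
    rw [abs_mul, abs_of_nonneg h3]
    exact mul_le_mul_of_nonneg_left (hR _) h3
  calc _ ≤ _ := abs_add_le _ _
    _ ≤ (1 - ∑ i, w i) * R + (∑ i, w i) * R := add_le_add h2 h1
    _ = R := by ring

theorem integrableOn_comp_baryPoint {m : ℕ} {h : ℝ → ℝ} (hm : Measurable h) (hb : LocallyBdd h)
    (b : Fin (m + 1) → ℝ) : IntegrableOn (fun w => h (baryPoint b w)) (solidSimplex m) := by
  obtain ⟨C, hC⟩ := hb (∑ i, |b i|)
  refine Measure.integrableOn_of_bounded (volume_solidSimplex_ne_top m)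
    (hm.comp (continuous_baryPoint b).measurable).aestronglyMeasurable (M := C) ?_
  refine (ae_restrict_iff' (measurableSet_solidSimplex m)).2 (.of_forall fun w hw => ?_)
  exact hC _ (abs_baryPoint_le b
    (fun i => Finset.single_le_sum (f := fun i => |b i|) (fun j _ => abs_nonneg _)
      (Finset.mem_univ i)) hw)

theorem insertNth_mem_solidSimplex {m : ℕ} (j : Fin (m + 1)) (u : ℝ) (w : Fin m → ℝ) :
    (j.insertNth u w : Fin (m + 1) → ℝ) ∈ solidSimplex (m + 1) ↔
      (∀ i, 0 ≤ w i) ∧ u ∈ Set.Icc 0 (1 - ∑ i, w i) := by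
  simp only [solidSimplex, Set.mem_ofPred_eq, Fin.forall_iff_succAbove j,
    Fin.sum_univ_succAbove _ j, Fin.insertNth_apply_same, Fin.insertNth_apply_succAbove, Set.mem_Icc]
  constructor
  · rintro ⟨⟨h1, h2⟩, h3⟩
    exact ⟨h2, h1, by linarith⟩
  · rintro ⟨h2, h1, h3⟩
    exact ⟨⟨h1, h2⟩, by linarith⟩

/-- Integration over the solid simplex with the `j`-th weight as innermost variable. -/
theorem integral_solidSimplex_succ {m : ℕ} (j : Fin (m + 1)) (F : (Fin (m + 1) → ℝ) → ℝ)
    (hF : IntegrableOn F (solidSimplex (m + 1))) :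
    ∫ w in solidSimplex (m + 1), F w =
      ∫ w in solidSimplex m, ∫ u in (0 : ℝ)..(1 - ∑ i, w i), F (j.insertNth u w) := by
  have hmp := (volume_preserving_piFinSuccAbove (fun _ : Fin (m + 1) => ℝ) j).symm
  have hF' : Integrable ((solidSimplex (m + 1)).indicator F) :=
    (integrable_indicator_iff (measurableSet_solidSimplex _)).2 hF
  rw [← integral_indicator (measurableSet_solidSimplex _),
    ← integral_indicator (measurableSet_solidSimplex _), ← hmp.integral_comp',
    Measure.volume_eq_prod,
    integral_prod_symm (fun z => (solidSimplex (m + 1)).indicator F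
      ((MeasurableEquiv.piFinSuccAbove (fun _ : Fin (m + 1) => ℝ) j).symm z))
      (hmp.integrable_comp_of_integrable hF')]
  refine integral_congr_ae (.of_forall fun w => ?_)
  have he : ∀ u, (MeasurableEquiv.piFinSuccAbove (fun _ : Fin (m + 1) => ℝ) j).symm (u, w)
      = (j.insertNth u w : Fin (m + 1) → ℝ) := fun u => rfl
  simp only [he]
  by_cases hw : w ∈ solidSimplex m
  · rw [Set.indicator_of_mem hw, intervalIntegral.integral_of_le (sub_nonneg.2 hw.2),
      ← integral_Icc_eq_integral_Ioc, ← integral_indicator measurableSet_Icc]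
    refine integral_congr_ae (.of_forall fun u => ?_)
    simp only [Set.indicator, insertNth_mem_solidSimplex, hw.1, implies_true, true_and]
  · rw [Set.indicator_of_notMem hw]
    refine integral_eq_zero_of_ae (.of_forall fun u => ?_)
    refine Set.indicator_of_notMem (fun h => hw ?_) _
    rw [insertNth_mem_solidSimplex] at h
    exact ⟨h.1, by linarith [h.2.1, h.2.2]⟩

theorem baryPoint_insertNth {m : ℕ} (b : Fin (m + 2) → ℝ) (j : Fin (m + 1)) (u : ℝ)
    (w : Fin m → ℝ) : baryPoint b (j.insertNth u w) =
      b 0 + u * (b j.succ - b 0) + ∑ i, w i * (b (j.succAbove i).succ - b 0) := by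
  simp only [baryPoint, Fin.sum_univ_succAbove _ j, Fin.insertNth_apply_same,
    Fin.insertNth_apply_succAbove]
  ring

/-! ### Symmetry of the simplex integral in the knots -/

theorem simplexIntegral_comp_swap_zero {m : ℕ} {h : ℝ → ℝ} (hm : Measurable h) (hb : LocallyBdd h)
    (b : Fin (m + 1) → ℝ) (j : Fin (m + 1)) :
    simplexIntegral h (b ∘ Equiv.swap 0 j) = simplexIntegral h b := by
  obtain rfl | ⟨k, rfl⟩ := Fin.eq_zero_or_eq_succ j
  · simp
  cases m with
  | zero => exact k.elim0
  | succ m =>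
  rw [simplexIntegral, simplexIntegral,
    integral_solidSimplex_succ k _ (integrableOn_comp_baryPoint hm hb _),
    integral_solidSimplex_succ k _ (integrableOn_comp_baryPoint hm hb _)]
  refine integral_congr_ae (.of_forall fun w => ?_)
  -- Exchanging `b 0` with knot `k.succ` exchanges their weights `1 - ∑ w_i - u` and `u`, which is
  -- the reflection of the inner interval.
  have h1 := intervalIntegral.integral_comp_sub_left (a := 0) (b := 1 - ∑ i, w i)
    (fun u => h (baryPoint b (k.insertNth u w))) (1 - ∑ i, w i)
  simp only [sub_self, sub_zero] at h1
  simp only [← h1]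
  refine intervalIntegral.integral_congr fun u _ => ?_
  simp only [baryPoint_insertNth, Function.comp_apply, Equiv.swap_apply_left,
    Equiv.swap_apply_right]
  congr 1
  have h2 : ∀ i, Equiv.swap 0 k.succ (k.succAbove i).succ = (k.succAbove i).succ := fun i =>
    Equiv.swap_apply_of_ne_of_ne (Fin.succ_ne_zero _)
      (fun h => Fin.succAbove_ne k i (Fin.succ_injective _ h))
  simp only [h2, mul_sub, Finset.sum_sub_distrib, ← Finset.sum_mul]
  ring

theorem simplexIntegral_comp_perm {m : ℕ} {h : ℝ → ℝ} (hm : Measurable h) (hb : LocallyBdd h)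
    (b : Fin (m + 1) → ℝ) (σ : Equiv.Perm (Fin (m + 1))) :
    simplexIntegral h (b ∘ σ) = simplexIntegral h b := by
  induction σ using Equiv.Perm.swap_induction_on generalizing b with
  | one => rfl
  | swap_mul f x y hxy ih =>
    rw [Equiv.Perm.coe_mul, ← Function.comp_assoc, ih]
    by_cases hx : x = 0
    · rw [hx]; exact simplexIntegral_comp_swap_zero hm hb b y
    by_cases hy : y = 0
    · rw [hy, Equiv.swap_comm]; exact simplexIntegral_comp_swap_zero hm hb b x
    -- Transpositions involving `0` suffice, since the others are conjugates of them.
    have : Equiv.swap x y = Equiv.swap 0 x * Equiv.swap 0 y * Equiv.swap 0 x := by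
      rw [Equiv.swap_comm 0 y, Equiv.swap_mul_swap_mul_swap hy (Ne.symm hxy)]
    rw [this, Equiv.Perm.coe_mul, Equiv.Perm.coe_mul, ← Function.comp_assoc, ← Function.comp_assoc,
      simplexIntegral_comp_swap_zero hm hb, simplexIntegral_comp_swap_zero hm hb,
      simplexIntegral_comp_swap_zero hm hb]

/-! ### Affine forms and null sets -/

theorem quasiMeasurePreserving_of_linearMap_ne_zero {m : ℕ} (L : (Fin m → ℝ) →ₗ[ℝ] ℝ)
    (hL : L ≠ 0) : Measure.QuasiMeasurePreserving L volume volume := by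
  obtain ⟨c, -, hc⟩ := L.exists_map_addHaar_eq_smul_addHaar volume volume
    (LinearMap.surjective_of_ne_zero hL)
  exact ⟨L.continuous_of_finiteDimensional.measurable,
    hc ▸ Measure.AbsolutelyContinuous.rfl.smul_left c⟩

/-- A nonconstant affine form does not charge null sets. -/
theorem volume_baryPoint_preimage_eq_zero {m : ℕ} (b : Fin (m + 1) → ℝ) (hb : ∃ i, b i ≠ b 0)
    {A : Set ℝ} (hA : volume A = 0) : volume (baryPoint b ⁻¹' A) = 0 := by
  let L : (Fin m → ℝ) →ₗ[ℝ] ℝ := ∑ i, (b i.succ - b 0) • LinearMap.proj i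
  have hLa : ∀ w, L w = ∑ i, w i * (b i.succ - b 0) := fun w => by
    simp [L, LinearMap.sum_apply, mul_comm]
  have hL : L ≠ 0 := by
    obtain ⟨i, hi⟩ := hb
    obtain rfl | ⟨k, rfl⟩ := Fin.eq_zero_or_eq_succ i
    · exact absurd rfl hi
    intro h0
    have := hLa (Pi.single k 1)
    simp [h0, Pi.single_apply] at this
    exact hi (by linarith)
  have h1 : volume ((fun x => b 0 + x) ⁻¹' A) = 0 := by rwa [measure_preimage_add]
  have h2 := (quasiMeasurePreserving_of_linearMap_ne_zero L hL).preimage_null h1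
  convert h2 using 2
  ext w
  simp [baryPoint, hLa]

theorem baryPoint_eq_of_forall_eq {m : ℕ} (b : Fin (m + 1) → ℝ) (hb : ∀ i, b i = b 0)
    (w : Fin m → ℝ) : baryPoint b w = b 0 := by
  simp [baryPoint, hb]

/-- A nonconstant form hits a countable set only on a null set; a constant one takes the value `b 0`
alone. -/
theorem ae_baryPoint_notMem {m : ℕ} (b : Fin (m + 1) → ℝ) {D : Set ℝ} (hD : D.Countable)
    (hb : (∃ i, b i ≠ b 0) ∨ b 0 ∉ D) : ∀ᵐ w : Fin m → ℝ, baryPoint b w ∉ D := by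
  by_cases h : ∃ i, b i ≠ b 0
  · exact measure_eq_zero_iff_ae_notMem.1
      (volume_baryPoint_preimage_eq_zero b h (hD.measure_zero volume))
  · refine .of_forall fun w => ?_
    rw [baryPoint_eq_of_forall_eq b (by push Not at h; exact h) w]
    exact hb.resolve_left h

/-! ### The Hermite–Genocchi formula -/

theorem simplexIntegral_succ {m : ℕ} {h : ℝ → ℝ} (hm : Measurable h) (hb : LocallyBdd h)
    (a : Fin (m + 2) → ℝ) : simplexIntegral h a = ∫ w in solidSimplex m,
      ∫ u in (0 : ℝ)..(1 - ∑ i, w i),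
        h (baryPoint (Fin.init a) w + (a (Fin.last (m + 1)) - a 0) * u) := by
  rw [simplexIntegral,
    integral_solidSimplex_succ (Fin.last m) _ (integrableOn_comp_baryPoint hm hb _)]
  refine integral_congr_ae (.of_forall fun w => intervalIntegral.integral_congr fun u _ => ?_)
  rw [baryPoint_insertNth]
  simp only [Fin.succAbove_last, Fin.succ_last, baryPoint, Fin.init, ← Fin.succ_castSucc,
    Fin.castSucc_zero]
  congr 1
  ring

/-- By symmetry in the knots, the two terms of the divided difference recursion may thus be compared
as integrals that differ in the zeroth knot only. -/
theorem update_init_comp_finRotate {m : ℕ} (a : Fin (m + 2) → ℝ) :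
    Function.update (Fin.init a) 0 (a (Fin.last (m + 1))) ∘ finRotate (m + 1)
      = (Fin.tail a : Fin (m + 1) → ℝ) := by
  funext i
  induction i using Fin.lastCases with
  | last => simp [Fin.tail]
  | cast i =>
    have h : finRotate (m + 1) i.castSucc = i.succ := by
      rw [finRotate_apply, Fin.coeSucc_eq_succ]
    rw [Function.comp_apply, h, Function.update_of_ne (Fin.succ_ne_zero i)]
    rfl

theorem baryPoint_update_init {m : ℕ} (a : Fin (m + 2) → ℝ) (t : ℝ) (w : Fin m → ℝ) :
    baryPoint (Function.update (Fin.init a) 0 t : Fin (m + 1) → ℝ) w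
      = baryPoint (Fin.init a) w + (t - a 0) * (1 - ∑ i, w i) := by
  simp only [baryPoint_eq, Function.update_self, Function.update_of_ne (Fin.succ_ne_zero _),
    Fin.init, Fin.castSucc_zero]
  ring

theorem integral_eq_sub_of_off_countable {p h : ℝ → ℝ} {D : Set ℝ} (hD : D.Countable)
    (hp : Continuous p) (hm : Measurable h) (hb : LocallyBdd h)
    (hd : ∀ x ∉ D, HasDerivAt p (h x) x) (x z : ℝ) : ∫ u in x..z, h u = p z - p x := by
  refine integral_eq_of_hasDerivAt_off_countable p h hD hp.continuousOn
    (fun u hu => hd u hu.2) ?_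
  obtain ⟨C, hC⟩ := hb (max |x| |z|)
  rw [intervalIntegrable_iff]
  refine Measure.integrableOn_of_bounded (by simp) hm.aestronglyMeasurable (M := C) ?_
  refine (ae_restrict_iff' measurableSet_uIoc).2 (.of_forall fun u hu => hC u ?_)
  have := Set.uIoc_subset_uIcc hu
  exact abs_le_max_abs_abs this.1 this.2 |>.trans (by
    rcases le_total x z with hxz | hxz <;> simp [hxz, le_total])

/-- The inner variable moves weight from knot `a 0` to the last knot. The fundamental theorem of
calculus evaluates the inner integral, and its endpoints are the barycentric points for `Fin.init a`
and, after a rotation, `Fin.tail a`. -/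
theorem simplexIntegral_succ_of_ne {m : ℕ} {p h : ℝ → ℝ} {D : Set ℝ} (hD : D.Countable)
    (hp : Continuous p) (hm : Measurable h) (hb : LocallyBdd h)
    (hd : ∀ x ∉ D, HasDerivAt p (h x) x) (a : Fin (m + 2) → ℝ)
    (ha : a 0 ≠ a (Fin.last (m + 1))) :
    simplexIntegral h a = (simplexIntegral p (Fin.tail a) - simplexIntegral p (Fin.init a))
      / (a (Fin.last (m + 1)) - a 0) := by
  have hδ : a (Fin.last (m + 1)) - a 0 ≠ 0 := sub_ne_zero.2 ha.symm
  rw [simplexIntegral_succ hm hb, ← update_init_comp_finRotate,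
    simplexIntegral_comp_perm hp.measurable hp.locallyBdd, simplexIntegral, simplexIntegral,
    ← integral_sub (integrableOn_comp_baryPoint hp.measurable hp.locallyBdd _)
      (integrableOn_comp_baryPoint hp.measurable hp.locallyBdd _), ← integral_div]
  refine integral_congr_ae (.of_forall fun w => ?_)
  simp only [intervalIntegral.integral_comp_add_mul h hδ,
    integral_eq_sub_of_off_countable hD hp hm hb hd, baryPoint_update_init, mul_zero, add_zero,
    smul_eq_mul]
  field_simp

/-- Moving weight between equal knots changes nothing, so the inner integral is a length. That
length is also the derivative of the barycentric point in its zeroth knot. -/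
theorem simplexIntegral_succ_of_eq {m : ℕ} {h : ℝ → ℝ} (hm : Measurable h) (hb : LocallyBdd h)
    (a : Fin (m + 2) → ℝ) (ha : a 0 = a (Fin.last (m + 1))) :
    simplexIntegral h a
      = ∫ w in solidSimplex m, (1 - ∑ i, w i) * h (baryPoint (Fin.init a) w) := by
  rw [simplexIntegral_succ hm hb]
  simp [ha]

/-- Differentiation under the integral sign. Being a primitive of a locally bounded function, `p` is
Lipschitz on bounded sets, which gives the domination; for almost every `w` the barycentric point
avoids `D`, so the chain rule applies there. -/
theorem hasDerivAt_simplexIntegral_update {m : ℕ} {p h : ℝ → ℝ} {D : Set ℝ} (hD : D.Countable)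
    (hp : Continuous p) (hm : Measurable h) (hb : LocallyBdd h)
    (hd : ∀ x ∉ D, HasDerivAt p (h x) x) (a : Fin (m + 2) → ℝ)
    (ha : a 0 = a (Fin.last (m + 1))) (haD : (∃ i, a i ≠ a 0) ∨ a 0 ∉ D) :
    HasDerivAt (fun t => simplexIntegral p (Function.update (Fin.init a) 0 t : Fin (m + 1) → ℝ))
      (simplexIntegral h a) (a 0) := by
  rw [simplexIntegral_succ_of_eq hm hb a ha]
  have hinit : (∃ i, (Fin.init a : Fin (m + 1) → ℝ) i ≠ (Fin.init a : Fin (m + 1) → ℝ) 0) ∨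
      (Fin.init a : Fin (m + 1) → ℝ) 0 ∉ D := by
    refine haD.imp (fun ⟨i, hi⟩ => ?_) id
    induction i using Fin.lastCases with
    | last => exact absurd ha.symm hi
    | cast i => exact ⟨i, hi⟩
  -- The extra `1` leaves room for the zeroth knot to vary in the unit ball around `a 0`.
  obtain ⟨C, hC⟩ := hb (∑ i, |a i| + 1)
  have hlip : ∀ x z, |x| ≤ ∑ i, |a i| + 1 → |z| ≤ ∑ i, |a i| + 1 →
      |p x - p z| ≤ |C| * |x - z| := by
    intro x z hx hz
    rw [← integral_eq_sub_of_off_countable hD hp hm hb hd, ← Real.norm_eq_abs]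
    refine intervalIntegral.norm_integral_le_of_norm_le_const fun u hu => ?_
    refine (hC u ?_).trans (le_abs_self C)
    have := Set.uIoc_subset_uIcc hu
    refine (abs_le_max_abs_abs this.1 this.2).trans ?_
    rcases le_total x z with hxz | hxz <;> simp [hxz, hx, hz]
  have hle : ∀ i, |a i| ≤ ∑ i, |a i| := fun i =>
    Finset.single_le_sum (f := fun i => |a i|) (fun j _ => abs_nonneg _) (Finset.mem_univ i)
  refine (hasDerivAt_integral_of_dominated_loc_of_lip
    (F := fun t w => p (baryPoint (Function.update (Fin.init a) 0 t : Fin (m + 1) → ℝ) w))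
    (bound := fun _ => C) (Metric.ball_mem_nhds (a 0) one_pos) (.of_forall fun t => ?_) ?_ ?_ ?_ ?_
    ?_).2
  · exact (hp.comp (continuous_baryPoint _)).aestronglyMeasurable
  · exact integrableOn_comp_baryPoint hp.measurable hp.locallyBdd _
  · exact ((continuous_const.sub (continuous_finsetSum _ fun i _ => continuous_apply i)).measurable.mul
      (hm.comp (continuous_baryPoint _).measurable)).aestronglyMeasurable
  · refine (ae_restrict_iff' (measurableSet_solidSimplex m)).2 (.of_forall fun w hw => ?_)
    have hbd : ∀ t ∈ Metric.ball (a 0) 1,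
        |baryPoint (Function.update (Fin.init a) 0 t : Fin (m + 1) → ℝ) w|
          ≤ ∑ i, |a i| + 1 := by
      intro t ht
      refine abs_baryPoint_le _ (fun i => ?_) hw
      by_cases hi : i = 0
      · subst hi
        rw [Function.update_self]
        have h1 : |t - a 0| < 1 := by simpa [Real.dist_eq] using ht
        have h2 := abs_sub_abs_le_abs_sub t (a 0)
        linarith [hle 0]
      · rw [Function.update_of_ne hi]
        linarith [hle i.castSucc, show |(Fin.init a : Fin (m + 1) → ℝ) i| = |a i.castSucc| from rfl]
    refine LipschitzOnWith.of_dist_le_mul fun t ht s hs => ?_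
    rw [Real.dist_eq, Real.dist_eq, Real.coe_nnabs]
    refine (hlip _ _ (hbd t ht) (hbd s hs)).trans
      (mul_le_mul_of_nonneg_left ?_ (abs_nonneg C))
    rw [baryPoint_update_init, baryPoint_update_init]
    have h3 : 0 ≤ 1 - ∑ i, w i := sub_nonneg.2 hw.2
    have h4 : 1 - ∑ i, w i ≤ 1 := by linarith [Finset.sum_nonneg fun i (_ : i ∈ Finset.univ) => hw.1 i]
    calc _ = |t - s| * |1 - ∑ i, w i| := by rw [← abs_mul]; congr 1; ring
      _ ≤ |t - s| * 1 := by
        rw [abs_of_nonneg h3]; exact mul_le_mul_of_nonneg_left h4 (abs_nonneg _)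
      _ = _ := mul_one _
  · exact integrable_const C
  · filter_upwards [ae_restrict_of_ae (ae_baryPoint_notMem _ hD hinit)] with w hw
    simp only [baryPoint_update_init]
    have h1 : HasDerivAt (fun t => baryPoint (Fin.init a) w + (t - a 0) * (1 - ∑ i, w i))
        (1 - ∑ i, w i) (a 0) := by
      simpa using (((hasDerivAt_id (a 0)).sub_const (a 0)).mul_const (1 - ∑ i, w i)).const_add
        (baryPoint (Fin.init a) w)
    have h2 : HasDerivAt p (h (baryPoint (Fin.init a) w))
        (baryPoint (Fin.init a) w + (a 0 - a 0) * (1 - ∑ i, w i)) := by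
      simpa using hd _ hw
    rw [mul_comm]
    exact h2.comp (a 0) h1

/-- The induction step of the Hermite–Genocchi formula; the top derivative may fail to exist on a
countable set. -/
theorem divDiff_succ_eq_simplexIntegral {m : ℕ} {g p h : ℝ → ℝ} {D : Set ℝ} (hD : D.Countable)
    (hp : Continuous p) (hm : Measurable h) (hb : LocallyBdd h)
    (hd : ∀ x ∉ D, HasDerivAt p (h x) x) (hg : ∀ b, divDiff g m b = simplexIntegral p b)
    (a : Fin (m + 2) → ℝ) (haD : (∃ i, a i ≠ a 0) ∨ a 0 ∉ D) :
    divDiff g (m + 1) a = simplexIntegral h a := by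
  rw [divDiff]
  simp only [hg]
  split_ifs with ha
  · exact (simplexIntegral_succ_of_ne hD hp hm hb hd a ha).symm
  · exact (hasDerivAt_simplexIntegral_update hD hp hm hb hd a (not_not.1 ha) haD).deriv

theorem simplexIntegral_zero (h : ℝ → ℝ) (b : Fin 1 → ℝ) : simplexIntegral h b = h (b 0) := by
  have h1 : solidSimplex 0 = Set.univ := by ext w; simp [solidSimplex]
  rw [simplexIntegral, h1, Measure.restrict_univ, volume_pi, Measure.pi_of_empty, integral_dirac]
  simp [baryPoint]

/-- The Hermite–Genocchi formula for a chain of derivatives. -/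
theorem divDiff_eq_simplexIntegral {G : ℕ → ℝ → ℝ} {n : ℕ}
    (hG : ∀ k < n, ∀ x, HasDerivAt (G k) (G (k + 1) x) x) (hc : Continuous (G n))
    (a : Fin (n + 1) → ℝ) : divDiff (G 0) n a = simplexIntegral (G n) a := by
  induction n with
  | zero => rw [simplexIntegral_zero, divDiff]
  | succ n ih =>
    have hcn : Continuous (G n) :=
      continuous_iff_continuousAt.2 fun x => (hG n n.lt_succ_self x).continuousAt
    exact divDiff_succ_eq_simplexIntegral Set.countable_empty hcn hc.measurable hc.locallyBdd
      (fun x _ => hG n n.lt_succ_self x) (fun b => ih (fun k hk => hG k (by omega)) hcn b) a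
      (Or.inr (Set.notMem_empty _))

/-- The Hermite–Genocchi formula when the last derivative may fail to exist on a countable set. -/
theorem divDiff_eq_simplexIntegral_of_off_countable {G : ℕ → ℝ → ℝ} {n : ℕ} {D : Set ℝ}
    (hD : D.Countable) (hG : ∀ k < n, ∀ x, HasDerivAt (G k) (G (k + 1) x) x)
    (hc : Continuous (G n)) (hm : Measurable (G (n + 1))) (hb : LocallyBdd (G (n + 1)))
    (hd : ∀ x ∉ D, HasDerivAt (G n) (G (n + 1) x) x)
    (a : Fin (n + 2) → ℝ) (haD : (∃ i, a i ≠ a 0) ∨ a 0 ∉ D) :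
    divDiff (G 0) (n + 1) a = simplexIntegral (G (n + 1)) a :=
  divDiff_succ_eq_simplexIntegral hD hc hm hb hd
    (fun b => divDiff_eq_simplexIntegral hG hc b) a haD

theorem ContDiff.divDiff_eq {f : ℝ → ℝ} {n : ℕ} (hf : ContDiff ℝ n f) (a : Fin (n + 1) → ℝ) :
    divDiff f n a = simplexIntegral (iteratedDeriv n f) a := by
  have h := divDiff_eq_simplexIntegral (G := fun k => iteratedDeriv k f) (n := n)
    (fun k hk x => ?_) (hf.continuous_iteratedDeriv n le_rfl) a
  · simpa only [iteratedDeriv_zero] using h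
  · rw [iteratedDeriv_succ]
    exact (hf.differentiable_iteratedDeriv k (by exact_mod_cast hk) x).hasDerivAt

/-! ### Chambers of the cube and gap coordinates -/

/-- The matrix of `w ↦ (∑_{j ≥ i} w_j)_i`. -/
def tailSumMatrix (n : ℕ) : Matrix (Fin n) (Fin n) ℝ := fun i j => if i ≤ j then 1 else 0

/-- The vector of the tail sums `∑_{j ≥ i} w_j`. -/
def tailSum {n : ℕ} (w : Fin n → ℝ) (i : Fin n) : ℝ := ∑ j ∈ Finset.Ici i, w j

theorem toLin'_tailSumMatrix {n : ℕ} (w : Fin n → ℝ) :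
    Matrix.toLin' (tailSumMatrix n) w = tailSum w := by
  ext i
  simp [tailSumMatrix, tailSum, Matrix.mulVec, dotProduct, ← Finset.sum_filter,
    Finset.filter_le_eq_Ici]

theorem det_tailSumMatrix (n : ℕ) : (tailSumMatrix n).det = 1 := by
  rw [Matrix.det_of_isUpperTriangular]
  · simp [tailSumMatrix]
  · intro i j hij
    exact if_neg (not_le.2 hij)

theorem measurePreserving_tailSum (n : ℕ) :
    MeasurePreserving (tailSum : (Fin n → ℝ) → Fin n → ℝ) := by
  have h : (tailSum : (Fin n → ℝ) → Fin n → ℝ) = Matrix.toLin' (tailSumMatrix n) := by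
    funext w; exact (toLin'_tailSumMatrix w).symm
  rw [h]
  refine ⟨(LinearMap.continuous_of_finiteDimensional _).measurable, ?_⟩
  rw [Real.map_matrix_volume_pi_eq_smul_volume_pi (by simp [det_tailSumMatrix]), det_tailSumMatrix]
  simp

theorem measurePreserving_comp_perm {n : ℕ} (σ : Equiv.Perm (Fin n)) :
    MeasurePreserving (fun (z : Fin n → ℝ) k => z (σ k)) := by
  have h : (fun (z : Fin n → ℝ) k => z (σ k))
      = MeasurableEquiv.piCongrLeft (fun _ : Fin n => ℝ) σ.symm := by
    funext z k
    have := Equiv.piCongrLeft_apply_apply (fun _ : Fin n => ℝ) σ.symm z (σ k)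
    rw [Equiv.symm_apply_apply] at this
    exact this.symm
  rw [h]
  exact volume_measurePreserving_piCongrLeft (fun _ : Fin n => ℝ) σ.symm

/-- The vector whose nonincreasing rearrangement along `σ` has the gaps `w`. -/
def chamberMap {n : ℕ} (σ : Equiv.Perm (Fin n)) (w : Fin n → ℝ) : Fin n → ℝ :=
  fun k => tailSum w (σ.symm k)

theorem measurePreserving_chamberMap {n : ℕ} (σ : Equiv.Perm (Fin n)) :
    MeasurePreserving (chamberMap σ) :=
  (measurePreserving_comp_perm σ.symm).comp (measurePreserving_tailSum n)

theorem chamberMap_apply {n : ℕ} (σ : Equiv.Perm (Fin n)) (w : Fin n → ℝ) (i : Fin n) :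
    chamberMap σ w (σ i) = tailSum w i := by
  simp [chamberMap]

/-- The vectors of the unit cube that `σ` sorts in nonincreasing order. -/
def chamber {n : ℕ} (σ : Equiv.Perm (Fin n)) : Set (Fin n → ℝ) :=
  Set.Icc 0 1 ∩ {x | Antitone (x ∘ σ)}

theorem isClosed_setOf_antitone_comp {n : ℕ} (σ : Equiv.Perm (Fin n)) :
    IsClosed {x : Fin n → ℝ | Antitone (x ∘ σ)} := by
  have : {x : Fin n → ℝ | Antitone (x ∘ σ)}
      = ⋂ i, ⋂ j, ⋂ _ : i ≤ j, {x | x (σ j) ≤ x (σ i)} := by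
    ext x; simp [Antitone]
  rw [this]
  exact isClosed_iInter fun i => isClosed_iInter fun j => isClosed_iInter fun _ =>
    isClosed_le (continuous_apply _) (continuous_apply _)

theorem isClosed_chamber {n : ℕ} (σ : Equiv.Perm (Fin n)) : IsClosed (chamber σ) :=
  isClosed_Icc.inter (isClosed_setOf_antitone_comp σ)

theorem tailSum_castSucc {m : ℕ} (w : Fin (m + 1) → ℝ) (k : Fin m) :
    tailSum w k.castSucc = w k.castSucc + tailSum w k.succ := by
  have h : Finset.Ici k.castSucc = insert k.castSucc (Finset.Ici k.succ) := by
    ext i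
    simp only [Finset.mem_Ici, Finset.mem_insert, Fin.le_def, Fin.ext_iff, Fin.val_castSucc,
      Fin.val_succ]
    omega
  rw [tailSum, h, Finset.sum_insert (by simp), tailSum]

/-- Consecutive tail sums differ by a gap, the last one is a gap and the first one is the total. So
order and cube bounds translate into nonnegative gaps of sum at most `1`. -/
theorem chamberMap_preimage_chamber {n : ℕ} (hn : 1 ≤ n) (σ : Equiv.Perm (Fin n)) :
    chamberMap σ ⁻¹' chamber σ = solidSimplex n := by
  obtain ⟨m, rfl⟩ := Nat.exists_eq_add_of_le' hn
  ext w
  have hc : chamberMap σ w ∘ σ = tailSum w := funext fun i => chamberMap_apply σ w i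
  have h0 : tailSum w 0 = ∑ i, w i := by
    rw [tailSum]
    congr 1
    ext i
    simp
  simp only [Set.mem_preimage, chamber, Set.mem_inter_iff, Set.mem_ofPred_eq, hc, solidSimplex]
  constructor
  · rintro ⟨⟨h1, h2⟩, h3⟩
    refine ⟨fun i => ?_, ?_⟩
    · induction i using Fin.lastCases with
      | last =>
        have := h1 (σ (Fin.last m))
        rw [chamberMap_apply, tailSum] at this
        have hI : Finset.Ici (Fin.last m) = {Fin.last m} := by ext i; simp
        simpa [hI] using this
      | cast k =>
        have := h3 (Fin.castSucc_le_succ k)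
        rw [tailSum_castSucc] at this
        linarith
    · rw [← h0, ← chamberMap_apply σ]
      exact h2 _
  · rintro ⟨h1, h2⟩
    have hanti : Antitone (tailSum w) := fun i j hij =>
      Finset.sum_le_sum_of_subset_of_nonneg (Finset.Ici_subset_Ici.2 hij) fun k _ _ => h1 k
    refine ⟨⟨fun k => ?_, fun k => ?_⟩, hanti⟩
    · have hk : 0 ≤ tailSum w (σ.symm k) := Finset.sum_nonneg fun j _ => h1 j
      exact hk
    · exact (hanti (Fin.zero_le (σ.symm k))).trans (h0.trans_le h2)

theorem sum_Iic_succ_sub_castSucc {n : ℕ} (c : Fin (n + 1) → ℝ) (j : Fin n) :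
    ∑ i ∈ Finset.Iic j, (c i.succ - c i.castSucc) = c j.succ - c 0 := by
  obtain ⟨m, rfl⟩ := Nat.exists_eq_add_of_le' (Fin.pos j)
  induction j using Fin.induction with
  | zero =>
    have : Finset.Iic (0 : Fin (m + 1)) = {0} := by ext i; simp
    simp [this]
  | succ k ih =>
    have h : Finset.Iic k.succ = insert k.succ (Finset.Iic k.castSucc) := by
      ext i
      simp only [Finset.mem_Iic, Finset.mem_insert, Fin.le_def, Fin.ext_iff, Fin.val_castSucc,
        Fin.val_succ]
      omega
    rw [h, Finset.sum_insert (by simp), ih, Fin.succ_castSucc]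
    ring

/-- Summation by parts: once the sums are exchanged, the increments of `cumul ν σ` multiplying the
gap `w j` telescope. -/
theorem choquetAlong_chamberMap {n : ℕ} (ν : Finset (Fin n) → ℝ) (hν : ν ∅ = 0)
    (σ : Equiv.Perm (Fin n)) (w : Fin n → ℝ) :
    choquetAlong ν σ (chamberMap σ w) = baryPoint (cumul ν σ) w := by
  have h0 : cumul ν σ 0 = 0 := by simp [cumul, prefixSet, hν]
  simp only [choquetAlong, chamberMap_apply, tailSum, baryPoint, ← sum_Iic_succ_sub_castSucc,
    Finset.mul_sum]
  rw [h0, zero_add, Finset.sum_comm' (t' := Finset.univ) (s' := fun j => Finset.Iic j) (by simp)]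
  exact Finset.sum_congr rfl fun j _ => Finset.sum_congr rfl fun i _ => mul_comm _ _

/-! ### Measurability of the Choquet integral and decomposition of the cube -/

theorem antitone_comp_sort {n : ℕ} (x : Fin n → ℝ) :
    Antitone (x ∘ Tuple.sort (fun i => OrderDual.toDual (x i))) :=
  fun _ _ hij => Tuple.monotone_sort (fun i => OrderDual.toDual (x i)) hij

theorem measurable_choquetAlong {n : ℕ} (ν : Finset (Fin n) → ℝ) (σ : Equiv.Perm (Fin n)) :
    Measurable (choquetAlong ν σ) := by
  unfold choquetAlong; fun_prop

theorem measurable_choquet {n : ℕ} (ν : Finset (Fin n) → ℝ) : Measurable (choquet ν) := by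
  intro A hA
  have h : choquet ν ⁻¹' A = ⋃ σ : Equiv.Perm (Fin n),
      {x | Antitone (x ∘ σ)} ∩ choquetAlong ν σ ⁻¹' A := by
    ext x
    simp only [Set.mem_preimage, Set.mem_iUnion, Set.mem_inter_iff, Set.mem_ofPred_eq]
    constructor
    · exact fun hx => ⟨_, antitone_comp_sort x, hx⟩
    · rintro ⟨σ, hσ, hx⟩
      rwa [choquet_eq ν x σ hσ]
  rw [h]
  exact .iUnion fun σ =>
    (isClosed_setOf_antitone_comp σ).measurableSet.inter (measurable_choquetAlong ν σ hA)

theorem volume_setOf_apply_eq_apply {n : ℕ} {i j : Fin n} (hij : i ≠ j) :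
    volume {x : Fin n → ℝ | x i = x j} = 0 := by
  let L : (Fin n → ℝ) →ₗ[ℝ] ℝ :=
    LinearMap.proj (R := ℝ) (φ := fun _ => ℝ) i - LinearMap.proj (R := ℝ) (φ := fun _ => ℝ) j
  have hL : L ≠ 0 := by
    intro h
    have := LinearMap.congr_fun h (Pi.single i 1)
    simp [L, hij.symm] at this
  have h := (quasiMeasurePreserving_of_linearMap_ne_zero _ hL).preimage_null
    (measure_singleton (μ := volume) (0 : ℝ))
  convert h using 2
  ext x
  simp [L, sub_eq_zero]

/-- The nonincreasing rearrangement is unique, so a common point satisfies `x (σ i) = x (τ i)`, a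
hyperplane when `σ i ≠ τ i`. -/
theorem aedisjoint_chamber {n : ℕ} {σ τ : Equiv.Perm (Fin n)} (h : σ ≠ τ) :
    AEDisjoint volume (chamber σ) (chamber τ) := by
  obtain ⟨i, hi⟩ : ∃ i, σ i ≠ τ i := by
    by_contra! hc
    exact h (Equiv.ext hc)
  refine measure_mono_null (fun x hx => ?_) (volume_setOf_apply_eq_apply hi)
  exact congrFun (Tuple.unique_antitone hx.1.2 hx.2.2) i

/-- The decomposition of the unit cube into chambers, each parametrized by the solid simplex. -/
theorem volume_cube_inter_choquet_preimage {n : ℕ} (hn : 1 ≤ n) (ν : Finset (Fin n) → ℝ)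
    (hν : ν ∅ = 0) {A : Set ℝ} (hA : MeasurableSet A) :
    volume (Set.Icc 0 1 ∩ choquet ν ⁻¹' A)
      = ∑ σ : Equiv.Perm (Fin n), volume (solidSimplex n ∩ baryPoint (cumul ν σ) ⁻¹' A) := by
  have h1 : Set.Icc 0 1 ∩ choquet ν ⁻¹' A
      = ⋃ σ ∈ (Finset.univ : Finset (Equiv.Perm (Fin n))), chamber σ ∩ choquet ν ⁻¹' A := by
    ext x
    simp only [Set.mem_inter_iff, Set.mem_iUnion, Finset.mem_univ, exists_const, chamber]
    exact ⟨fun h => ⟨_, ⟨h.1, antitone_comp_sort x⟩, h.2⟩, fun ⟨_, h, h'⟩ => ⟨h.1, h'⟩⟩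
  rw [h1, measure_biUnion_finset₀]
  · refine Finset.sum_congr rfl fun σ _ => ?_
    have hms : MeasurableSet (chamber σ ∩ choquet ν ⁻¹' A) :=
      (isClosed_chamber σ).measurableSet.inter (measurable_choquet ν hA)
    rw [← (measurePreserving_chamberMap σ).measure_preimage hms.nullMeasurableSet,
      Set.preimage_inter, chamberMap_preimage_chamber hn]
    congr 1
    ext w
    refine and_congr_right fun hw => ?_
    rw [← chamberMap_preimage_chamber hn σ] at hw
    rw [Set.mem_preimage, Set.mem_preimage, Set.mem_preimage, choquet_eq ν _ σ hw.2,
      choquetAlong_chamberMap ν hν]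
  · intro σ _ τ _ hστ
    exact (aedisjoint_chamber hστ).mono Set.inter_subset_left Set.inter_subset_left
  · intro σ _
    exact ((isClosed_chamber σ).measurableSet.inter (measurable_choquet ν hA)).nullMeasurableSet

/-! ### The law of the Choquet integral of uniform variables -/

theorem aemeasurable_of_isUniform_Icc {Ω : Type*} [MeasurableSpace Ω] {P : Measure Ω} {X : Ω → ℝ}
    (hX : pdf.IsUniform X (Set.Icc (0 : ℝ) 1) P volume) : AEMeasurable X P :=
  pdf.IsUniform.aemeasurable (by simp) (by simp) hX

theorem aemeasurable_choquet {n : ℕ} {Ω : Type*} [MeasurableSpace Ω] {P : Measure Ω}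
    {U : Fin n → Ω → ℝ} (ν : Finset (Fin n) → ℝ)
    (hU : ∀ i, pdf.IsUniform (U i) (Set.Icc (0 : ℝ) 1) P volume) :
    AEMeasurable (fun ω => choquet ν (fun i => U i ω)) P :=
  (measurable_choquet ν).comp_aemeasurable
    (aemeasurable_pi_lambda _ fun i => aemeasurable_of_isUniform_Icc (hU i))

section Law
variable {n : ℕ} {Ω : Type*} [MeasurableSpace Ω] {P : Measure Ω} [IsProbabilityMeasure P]
  {U : Fin n → Ω → ℝ}

theorem map_eq_volume_restrict_cube
    (hU : ∀ i, pdf.IsUniform (U i) (Set.Icc (0 : ℝ) 1) P volume) (hindep : iIndepFun U P) :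
    P.map (fun ω i => U i ω) = volume.restrict (Set.Icc 0 1) := by
  have h : ∀ i, P.map (U i) = volume.restrict (Set.Icc 0 1) := fun i => by
    rw [show P.map (U i) = _ from hU i, ProbabilityTheory.cond]
    simp
  rw [(iIndepFun_iff_map_fun_eq_pi_map fun i => aemeasurable_of_isUniform_Icc (hU i)).1 hindep]
  simp only [h]
  rw [← Measure.restrict_pi_pi, ← volume_pi, ← Set.pi_univ_Icc]
  rfl

theorem map_choquet_apply (hn : 1 ≤ n) (ν : Finset (Fin n) → ℝ) (hν : ν ∅ = 0)
    (hU : ∀ i, pdf.IsUniform (U i) (Set.Icc (0 : ℝ) 1) P volume) (hindep : iIndepFun U P)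
    {A : Set ℝ} (hA : MeasurableSet A) :
    P.map (fun ω => choquet ν (fun i => U i ω)) A
      = ∑ σ : Equiv.Perm (Fin n), volume (solidSimplex n ∩ baryPoint (cumul ν σ) ⁻¹' A) := by
  have h : P.map (fun ω => choquet ν (fun i => U i ω))
      = (P.map (fun ω i => U i ω)).map (choquet ν) :=
    (AEMeasurable.map_map_of_aemeasurable (measurable_choquet ν).aemeasurable
      (aemeasurable_pi_lambda _ fun i => aemeasurable_of_isUniform_Icc (hU i))).symm
  rw [h, map_eq_volume_restrict_cube hU hindep, Measure.map_apply (measurable_choquet ν) hA,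
    Measure.restrict_apply (measurable_choquet ν hA), Set.inter_comm,
    volume_cube_inter_choquet_preimage hn ν hν hA]

end Law

/-! ### Truncated powers and their divided differences -/

theorem truncPlus_of_pos {m : ℕ} {x : ℝ} (hx : 0 < x) : truncPlus m x = x ^ m := if_pos hx

theorem truncPlus_of_nonpos {m : ℕ} {x : ℝ} (hx : x ≤ 0) : truncPlus m x = 0 := if_neg hx.not_gt

/-- At `m = 0`, `x = 0` both truncated powers vanish while `0 ^ 0 = 1`, hence the exclusion. -/
theorem truncMinus_eq_pow_sub (m : ℕ) {x : ℝ} (h : m ≠ 0 ∨ x ≠ 0) :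
    truncMinus m x = x ^ m - truncPlus m x := by
  rcases lt_trichotomy x 0 with hx | hx | hx
  · simp [truncMinus, hx, truncPlus_of_nonpos hx.le]
  · subst hx
    simp [truncMinus, truncPlus, h.resolve_right (by simp)]
  · simp [truncMinus, hx.not_gt, truncPlus_of_pos hx]

theorem truncPlus_succ_eq (m : ℕ) (x : ℝ) : truncPlus (m + 1) x = max x 0 ^ (m + 1) := by
  rcases le_or_gt x 0 with hx | hx
  · simp [truncPlus_of_nonpos hx, hx]
  · rw [truncPlus_of_pos hx, max_eq_left hx.le]

theorem continuous_truncPlus_succ (m : ℕ) : Continuous (truncPlus (m + 1)) := by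
  rw [funext (truncPlus_succ_eq m)]
  fun_prop

theorem measurable_truncPlus (m : ℕ) : Measurable (truncPlus m) :=
  Measurable.ite measurableSet_Ioi (by fun_prop) measurable_const

theorem measurable_truncMinus (m : ℕ) : Measurable (truncMinus m) :=
  Measurable.ite measurableSet_Iio (by fun_prop) measurable_const

theorem hasDerivAt_truncPlus (m : ℕ) {x : ℝ} (h : m ≠ 0 ∨ x ≠ 0) :
    HasDerivAt (truncPlus (m + 1)) ((m + 1 : ℕ) * truncPlus m x) x := by
  rcases lt_trichotomy x 0 with hx | hx | hx
  · rw [truncPlus_of_nonpos hx.le, mul_zero]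
    refine (hasDerivAt_const x (0 : ℝ)).congr_of_eventuallyEq ?_
    filter_upwards [Iio_mem_nhds hx] with z hz using truncPlus_of_nonpos (le_of_lt hz)
  · subst hx
    obtain ⟨k, rfl⟩ := Nat.exists_eq_succ_of_ne_zero (h.resolve_right (by simp))
    have h0 : truncPlus (k + 1) 0 = 0 := truncPlus_of_nonpos le_rfl
    -- The slope of the truncated power of degree `k + 2` between `0` and `z` is the one of degree
    -- `k + 1` at `z`, which tends to `0`.
    rw [Nat.succ_eq_add_one, h0, mul_zero, hasDerivAt_iff_tendsto_slope]
    have hc := ((continuous_truncPlus_succ k).tendsto 0).mono_left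
      (nhdsWithin_le_nhds (s := {0}ᶜ))
    rw [h0] at hc
    refine hc.congr' ?_
    filter_upwards [self_mem_nhdsWithin] with z hz
    have hz : z ≠ 0 := hz
    rw [slope_def_field, truncPlus_succ_eq, truncPlus_succ_eq, truncPlus_succ_eq]
    rcases le_or_gt z 0 with h' | h'
    · simp [max_eq_right h']
    · simp only [max_eq_left h'.le]
      field_simp
      simp [pow_succ]
  · rw [truncPlus_of_pos hx]
    refine (hasDerivAt_pow (m + 1) x).congr_of_eventuallyEq ?_
    filter_upwards [Ioi_mem_nhds hx] with z hz using truncPlus_of_pos hz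

theorem hasDerivAt_truncMinus (m : ℕ) {x : ℝ} (h : m ≠ 0 ∨ x ≠ 0) :
    HasDerivAt (truncMinus (m + 1)) ((m + 1 : ℕ) * truncMinus m x) x := by
  rw [truncMinus_eq_pow_sub m h, mul_sub,
    show truncMinus (m + 1) = fun z => z ^ (m + 1) - truncPlus (m + 1) z from
      funext fun z => truncMinus_eq_pow_sub (m + 1) (Or.inl m.succ_ne_zero)]
  exact (hasDerivAt_pow (m + 1) x).sub (hasDerivAt_truncPlus m h)

theorem continuous_truncMinus_succ (m : ℕ) : Continuous (truncMinus (m + 1)) := by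
  rw [show truncMinus (m + 1) = fun z => z ^ (m + 1) - truncPlus (m + 1) z from
      funext fun z => truncMinus_eq_pow_sub (m + 1) (Or.inl m.succ_ne_zero)]
  exact (continuous_pow _).sub (continuous_truncPlus_succ m)

/-- The divided difference of order `n` of a shifted function `T n`, where `T` is a sequence with
`T (m + 1)' = (m + 1) T m` and `T 0` may jump at `0`. -/
theorem divDiff_comp_sub_eq {T : ℕ → ℝ → ℝ} (hc : ∀ m, Continuous (T (m + 1)))
    (hm : Measurable (T 0)) (hb : LocallyBdd (T 0))
    (hd : ∀ m x, (m ≠ 0 ∨ x ≠ 0) → HasDerivAt (T (m + 1)) ((m + 1 : ℕ) * T m x) x)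
    {n : ℕ} (hn : 1 ≤ n) (y : ℝ) (a : Fin (n + 1) → ℝ) (ha : (∃ i, a i ≠ a 0) ∨ a 0 ≠ y) :
    divDiff (fun x => T n (x - y)) n a
      = n.factorial * simplexIntegral (fun x => T 0 (x - y)) a := by
  obtain ⟨m, rfl⟩ := Nat.exists_eq_add_of_le' hn
  -- The successive derivatives of `T (m + 1) (· - y)`, ending with `(m + 1)! * T 0 (· - y)`; only
  -- the last differentiation can fail, and only at `y`.
  let G : ℕ → ℝ → ℝ := fun k x => ((m + 1).descFactorial k : ℝ) * T (m + 1 - k) (x - y)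
  have hG : ∀ k ≤ m, ∀ x, (k ≠ m ∨ x ≠ y) → HasDerivAt (G k) (G (k + 1) x) x := by
    intro k hk x hx
    obtain ⟨j, rfl⟩ := Nat.exists_eq_add_of_le hk
    have h1 := (hd j (x - y) (hx.imp (by omega) sub_ne_zero.2)).comp_sub_const x y
    have h2 := h1.const_mul ((k + j + 1).descFactorial k : ℝ)
    simp only [G, Nat.descFactorial_succ]
    rw [show k + j + 1 - k = j + 1 by omega, show k + j + 1 - (k + 1) = j by omega]
    refine h2.congr_deriv ?_
    push_cast
    ring
  have h := divDiff_eq_simplexIntegral_of_off_countable (G := G) (n := m) (D := {y})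
    (Set.countable_singleton y) (fun k hk x => hG k hk.le x (Or.inl hk.ne)) ?_ ?_ ?_
    (fun x hx => hG m le_rfl x (Or.inr hx)) a ha
  · have h0 : G 0 = fun x => T (m + 1) (x - y) := by funext x; simp [G]
    rw [← h0, h, simplexIntegral, simplexIntegral, ← integral_const_mul]
    simp only [G, Nat.sub_self, Nat.descFactorial_self]
  · simp only [G, Nat.add_sub_cancel_left]
    exact continuous_const.mul ((hc 0).comp (continuous_sub_right y))
  · simp only [G, Nat.sub_self]
    exact (hm.comp (measurable_id.sub_const y)).const_mul _
  · intro R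
    obtain ⟨C, hC⟩ := hb (R + |y|)
    refine ⟨(m + 1).descFactorial (m + 1) * C, fun x hx => ?_⟩
    simp only [G, Nat.sub_self, abs_mul, Nat.abs_cast]
    exact mul_le_mul_of_nonneg_left (hC _ ((abs_sub _ _).trans (by linarith))) (Nat.cast_nonneg _)

theorem divDiff_truncPlus_eq {n : ℕ} (hn : 1 ≤ n) (y : ℝ) (a : Fin (n + 1) → ℝ)
    (ha : (∃ i, a i ≠ a 0) ∨ a 0 ≠ y) :
    divDiff (fun x => truncPlus n (x - y)) n a
      = n.factorial * volume.real (solidSimplex n ∩ baryPoint a ⁻¹' Set.Ioi y) := by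
  rw [divDiff_comp_sub_eq continuous_truncPlus_succ (measurable_truncPlus 0) ?_
    (fun m x h => hasDerivAt_truncPlus m h) hn y a ha]
  · have h1 : (fun w => truncPlus 0 (baryPoint a w - y))
        = (baryPoint a ⁻¹' Set.Ioi y).indicator 1 := by
      funext w
      simp [truncPlus, Set.indicator]
    rw [simplexIntegral, h1, integral_indicator_one (measurableSet_Ioi.preimage
      (continuous_baryPoint a).measurable), measureReal_restrict_apply (measurableSet_Ioi.preimage
      (continuous_baryPoint a).measurable), Set.inter_comm]
  · refine fun _ => ⟨1, fun x _ => ?_⟩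
    rw [truncPlus]
    split_ifs <;> simp

theorem divDiff_truncMinus_eq {n : ℕ} (hn : 1 ≤ n) (y : ℝ) (a : Fin (n + 1) → ℝ)
    (ha : (∃ i, a i ≠ a 0) ∨ a 0 ≠ y) :
    divDiff (fun x => truncMinus n (x - y)) n a
      = n.factorial * volume.real (solidSimplex n ∩ baryPoint a ⁻¹' Set.Iio y) := by
  rw [divDiff_comp_sub_eq continuous_truncMinus_succ (measurable_truncMinus 0) ?_
    (fun m x h => hasDerivAt_truncMinus m h) hn y a ha]
  · have h1 : (fun w => truncMinus 0 (baryPoint a w - y))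
        = (baryPoint a ⁻¹' Set.Iio y).indicator 1 := by
      funext w
      simp [truncMinus, Set.indicator]
    rw [simplexIntegral, h1, integral_indicator_one (measurableSet_Iio.preimage
      (continuous_baryPoint a).measurable), measureReal_restrict_apply (measurableSet_Iio.preimage
      (continuous_baryPoint a).measurable), Set.inter_comm]
  · refine fun _ => ⟨1, fun x _ => ?_⟩
    rw [truncMinus]
    split_ifs <;> simp

/-! ### Differentiating the divided differences in `y` -/

/-- The divided difference depends only on the germs at the knots. -/
theorem divDiff_congr {f g : ℝ → ℝ} {S : Set ℝ} (hS : IsOpen S) (hfg : Set.EqOn f g S) :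
    ∀ (n : ℕ) (a : Fin (n + 1) → ℝ), (∀ i, a i ∈ S) → divDiff f n a = divDiff g n a
  | 0, a, ha => hfg (ha 0)
  | n + 1, a, ha => by
    have ht : ∀ i, (Fin.tail a : Fin (n + 1) → ℝ) i ∈ S := fun i => ha i.succ
    have hi : ∀ i, (Fin.init a : Fin (n + 1) → ℝ) i ∈ S := fun i => ha i.castSucc
    rw [divDiff, divDiff, divDiff_congr hS hfg n _ ht, divDiff_congr hS hfg n _ hi]
    congr 1
    refine Filter.EventuallyEq.deriv_eq ?_
    filter_upwards [hS.mem_nhds (ha 0)] with t ht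
    refine divDiff_congr hS hfg n _ fun i => ?_
    by_cases h : i = 0
    · subst h; rwa [Function.update_self]
    · rw [Function.update_of_ne h]; exact hi i

/-- Where knots coincide `divDiff` is a `deriv`, additive only under differentiability; for smooth
functions linearity is read off the integral formula. -/
theorem divDiff_sum {ι : Type*} (s : Finset ι) (c : ι → ℝ) {f : ι → ℝ → ℝ} {n : ℕ}
    (hf : ∀ i, ContDiff ℝ n (f i)) (a : Fin (n + 1) → ℝ) :
    divDiff (fun x => ∑ i ∈ s, c i * f i x) n a = ∑ i ∈ s, c i * divDiff (f i) n a := by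
  have hcf : ∀ i, ContDiff ℝ n (fun x => c i * f i x) := fun i => contDiff_const.mul (hf i)
  rw [(ContDiff.sum fun i _ => hcf i).divDiff_eq]
  simp only [(hf _).divDiff_eq, simplexIntegral, ← integral_const_mul]
  rw [← integral_finsetSum]
  · refine integral_congr_ae (.of_forall fun w => ?_)
    simp only
    rw [iteratedDeriv_fun_sum fun i _ => (hcf i).contDiffAt]
    exact Finset.sum_congr rfl fun i _ => iteratedDeriv_const_mul_field _ _
  · intro i _
    have := (hf i).continuous_iteratedDeriv n le_rfl
    exact (integrableOn_comp_baryPoint this.measurable this.locallyBdd a).const_mul _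

/-- Expanding `x - z = (y - z) + (x - y)` by the binomial theorem gives a polynomial in `y - z`. At
`z = y` only its linear term has a nonzero derivative. -/
theorem hasDerivAt_divDiff_mul_pow {χ : ℝ → ℝ} {n : ℕ} (hχ : ContDiff ℝ n χ) (a : Fin (n + 1) → ℝ)
    (hn : 1 ≤ n) (y : ℝ) : HasDerivAt (fun z => divDiff (fun x => χ x * (x - z) ^ n) n a)
      (-(n * divDiff (fun x => χ x * (x - y) ^ (n - 1)) n a)) y := by
  have h1 : ∀ z, divDiff (fun x => χ x * (x - z) ^ n) n a = ∑ k ∈ Finset.range (n + 1),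
      ((y - z) ^ k * n.choose k) * divDiff (fun x => χ x * (x - y) ^ (n - k)) n a := by
    intro z
    rw [← divDiff_sum _ (fun k => (y - z) ^ k * (n.choose k : ℝ))
      (f := fun k x => χ x * (x - y) ^ (n - k)) fun k => by fun_prop]
    congr 1
    funext x
    rw [show x - z = (y - z) + (x - y) by ring, add_pow, Finset.mul_sum]
    exact Finset.sum_congr rfl fun k _ => by ring
  simp only [h1]
  have h2 : ∀ k ∈ Finset.range (n + 1), HasDerivAt
      (fun z => ((y - z) ^ k * n.choose k) * divDiff (fun x => χ x * (x - y) ^ (n - k)) n a)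
      ((k * (y - y) ^ (k - 1) * (-1) * n.choose k)
        * divDiff (fun x => χ x * (x - y) ^ (n - k)) n a) y := fun k _ =>
    ((((hasDerivAt_id y).const_sub y).pow k).mul_const _).mul_const _
  refine (HasDerivAt.fun_sum h2).congr_deriv ?_
  rw [Finset.sum_eq_single 1]
  · simp
  · intro k _ hk
    rcases k with _ | _ | k
    · simp
    · exact absurd rfl hk
    · simp
  · intro h
    exact absurd (Finset.mem_range.2 (by omega)) h

theorem exists_smooth_step (y : ℝ) {δ : ℝ} (hδ : 0 < δ) (n : ℕ) :
    ∃ χ : ℝ → ℝ, ContDiff ℝ n χ ∧ (∀ x ≤ y - δ, χ x = 0) ∧ ∀ x, y + δ ≤ x → χ x = 1 := by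
  refine ⟨fun x => Real.smoothTransition ((x - (y - δ)) / (2 * δ)), ?_, fun x hx => ?_,
    fun x hx => ?_⟩
  · exact (Real.smoothTransition.contDiff (n := n)).comp (by fun_prop)
  · exact Real.smoothTransition.zero_of_nonpos
      (div_nonpos_of_nonpos_of_nonneg (by linarith) (by linarith))
  · exact Real.smoothTransition.one_of_one_le ((one_le_div (by linarith)).2 (by linarith))

/-- Only the germs at the knots matter. There, for all `z` near `y`, the truncated power agrees with
`χ x * (x - z) ^ m`, where the smooth step `χ` does not depend on `z`. Degree `n` gives the function
to differentiate and degree `n - 1` the B-spline. -/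
theorem hasDerivAt_divDiff_truncPlus {n : ℕ} (hn : 1 ≤ n) (a : Fin (n + 1) → ℝ) {y : ℝ}
    (hy : ∀ i, a i ≠ y) :
    HasDerivAt (fun z => divDiff (fun x => truncPlus n (x - z)) n a) (-bSpline n a y) y := by
  obtain ⟨δ, hδ, hδa⟩ : ∃ δ > 0, ∀ i, δ < |a i - y| := by
    have h : ∀ᶠ δ in nhdsWithin (0 : ℝ) (Set.Ioi 0), ∀ i, δ < |a i - y| :=
      Filter.eventually_all.2 fun i =>
        nhdsWithin_le_nhds (Iio_mem_nhds (abs_pos.2 (sub_ne_zero.2 (hy i))))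
    obtain ⟨δ, h1, h2⟩ := (h.and self_mem_nhdsWithin).exists
    exact ⟨δ, h2, h1⟩
  obtain ⟨χ, hχ, hχ0, hχ1⟩ := exists_smooth_step y hδ n
  have hS : IsOpen {x : ℝ | δ < |x - y|} := isOpen_lt continuous_const (by fun_prop)
  have key : ∀ m, ∀ z, |z - y| < δ → divDiff (fun x => truncPlus m (x - z)) n a
      = divDiff (fun x => χ x * (x - z) ^ m) n a := by
    intro m z hz
    refine divDiff_congr hS (fun x hx => ?_) n a hδa
    have hx : δ < |x - y| := hx
    rw [abs_lt] at hz
    rcases lt_abs.1 hx with h | h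
    · simp only [hχ1 x (by linarith), one_mul]
      exact truncPlus_of_pos (by linarith)
    · simp only [hχ0 x (by linarith), zero_mul]
      exact truncPlus_of_nonpos (by linarith)
  rw [bSpline, key (n - 1) y (by simpa using hδ)]
  refine (hasDerivAt_divDiff_mul_pow hχ a hn y).congr_of_eventuallyEq ?_
  filter_upwards [Metric.ball_mem_nhds y hδ] with z hz
  exact key n z (by simpa [Real.dist_eq] using hz)

/-! ### From the distribution function to the density -/

theorem cumul_zero {n : ℕ} {ν : Finset (Fin n) → ℝ} (hν : ν ∅ = 0) (σ : Equiv.Perm (Fin n)) :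
    cumul ν σ 0 = 0 := by
  simp [cumul, prefixSet, hν]

/-- A distribution function has the Radon–Nikodym derivative of its law as derivative almost
everywhere, so `f` agrees with it by uniqueness. This also gives the sign of `f`. -/
theorem eq_withDensity_of_hasDerivAt_cdf {μ : Measure ℝ} [IsProbabilityMeasure μ]
    (hμ : μ ≪ volume) {f : ℝ → ℝ} (hf : ∀ᵐ y, HasDerivAt (cdf μ) (f y) y) :
    (∀ᵐ y, 0 ≤ f y) ∧ μ = volume.withDensity fun y => ENNReal.ofReal (f y) := by
  have h : ∀ᵐ y, f y = (μ.rnDeriv volume y).toReal := by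
    filter_upwards [hf, (cdf μ).ae_hasDerivAt] with y h1 h2
    rw [measure_cdf] at h2
    exact h1.unique h2
  refine ⟨h.mono fun y hy => hy ▸ ENNReal.toReal_nonneg, ?_⟩
  conv_lhs => rw [← Measure.withDensity_rnDeriv_eq μ volume hμ]
  refine withDensity_congr_ae ?_
  filter_upwards [h, Measure.rnDeriv_lt_top μ volume] with y h1 h2
  rw [h1, ENNReal.ofReal_toReal h2.ne]

end

theorem theorem1 {n : ℕ} (hn : 1 ≤ n) (ν : Finset (Fin n) → ℝ) (hν : IsGame ν)
    {Ω : Type*} [MeasurableSpace Ω] (P : Measure Ω) [IsProbabilityMeasure P]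
    (U : Fin n → Ω → ℝ)
    (hU : ∀ i, pdf.IsUniform (U i) (Set.Icc (0 : ℝ) 1) P volume)
    (hindep : iIndepFun U P) :
    (∀ y : ℝ, (y ≠ 0 ∨ ∀ σ : Equiv.Perm (Fin n), ∃ i, cumul ν σ i ≠ 0) →
      P.real {ω | choquet ν (fun i => U i ω) ≤ y}
          = (1 / (n.factorial : ℝ)) * ∑ σ : Equiv.Perm (Fin n),
              divDiff (fun x => truncMinus n (x - y)) n (cumul ν σ) ∧
      P.real {ω | choquet ν (fun i => U i ω) ≤ y}
          = 1 - (1 / (n.factorial : ℝ)) * ∑ σ : Equiv.Perm (Fin n),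
              divDiff (fun x => truncPlus n (x - y)) n (cumul ν σ)) ∧
    ((∀ σ : Equiv.Perm (Fin n), ∃ i, cumul ν σ i ≠ 0) →
      (∀ᵐ y : ℝ, 0 ≤ (1 / (n.factorial : ℝ)) * ∑ σ : Equiv.Perm (Fin n),
          bSpline n (cumul ν σ) y) ∧
      P.map (fun ω => choquet ν (fun i => U i ω))
          = volume.withDensity (fun y => ENNReal.ofReal
              ((1 / (n.factorial : ℝ)) * ∑ σ : Equiv.Perm (Fin n),
                bSpline n (cumul ν σ) y))) := by
  have hν0 := hν.1
  have hYm := aemeasurable_choquet (P := P) ν hU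
  set μ := P.map (fun ω => choquet ν (fun i => U i ω)) with hμ
  have hprob : IsProbabilityMeasure μ := Measure.isProbabilityMeasure_map hYm
  have hfac : (n.factorial : ℝ) ≠ 0 := Nat.cast_ne_zero.2 n.factorial_ne_zero
  have hμA : ∀ A, MeasurableSet A → μ.real A = ∑ σ : Equiv.Perm (Fin n),
      volume.real (solidSimplex n ∩ baryPoint (cumul ν σ) ⁻¹' A) := fun A hA => by
    rw [measureReal_def, hμ, map_choquet_apply hn ν hν0 hU hindep hA, ENNReal.toReal_sum]
    · rfl
    · exact fun σ _ => measure_ne_top_of_subset Set.inter_subset_left (volume_solidSimplex_ne_top n)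
  have hP : ∀ y, P.real {ω | choquet ν (fun i => U i ω) ≤ y} = μ.real (Set.Iic y) := fun y => by
    rw [measureReal_def, measureReal_def, hμ, Measure.map_apply_of_aemeasurable hYm measurableSet_Iic]
    rfl
  have hcond : ∀ y : ℝ, (y ≠ 0 ∨ ∀ σ : Equiv.Perm (Fin n), ∃ i, cumul ν σ i ≠ 0) →
      ∀ σ, (∃ i, cumul ν σ i ≠ cumul ν σ 0) ∨ cumul ν σ 0 ≠ y := fun y hy σ => by
    rw [cumul_zero hν0]
    exact hy.symm.imp (fun h => h σ) Ne.symm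
  have hminus : ∀ y : ℝ, (y ≠ 0 ∨ ∀ σ : Equiv.Perm (Fin n), ∃ i, cumul ν σ i ≠ 0) →
      μ.real (Set.Iic y) = (1 / (n.factorial : ℝ)) * ∑ σ : Equiv.Perm (Fin n),
        divDiff (fun x => truncMinus n (x - y)) n (cumul ν σ) := fun y hy => by
    rw [hμA _ measurableSet_Iic, Finset.mul_sum]
    refine Finset.sum_congr rfl fun σ _ => ?_
    rw [divDiff_truncMinus_eq hn y _ (hcond y hy σ), ← mul_assoc, one_div_mul_cancel hfac, one_mul]
    -- The minus truncation gives `Set.Iio y`; the level set at `y`, by which `Set.Iic y` exceeds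
    -- it, is null.
    refine measureReal_congr ?_
    filter_upwards [ae_baryPoint_notMem (cumul ν σ) (Set.countable_singleton y) (hcond y hy σ)]
      with w hw
    refine congrArg (w ∈ solidSimplex n ∧ ·) (propext ?_)
    exact ⟨fun h => lt_of_le_of_ne h hw, le_of_lt (a := baryPoint (cumul ν σ) w)⟩
  have hplus : ∀ y : ℝ, (y ≠ 0 ∨ ∀ σ : Equiv.Perm (Fin n), ∃ i, cumul ν σ i ≠ 0) →
      μ.real (Set.Iic y) = 1 - (1 / (n.factorial : ℝ)) * ∑ σ : Equiv.Perm (Fin n),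
        divDiff (fun x => truncPlus n (x - y)) n (cumul ν σ) := fun y hy => by
    rw [← Set.compl_Ioi, probReal_compl_eq_one_sub measurableSet_Ioi, hμA _ measurableSet_Ioi,
      Finset.mul_sum]
    congr 1
    refine Finset.sum_congr rfl fun σ _ => ?_
    rw [divDiff_truncPlus_eq hn y _ (hcond y hy σ), ← mul_assoc, one_div_mul_cancel hfac, one_mul]
  refine ⟨fun y hy => ⟨(hP y).trans (hminus y hy), (hP y).trans (hplus y hy)⟩, fun hnd => ?_⟩
  refine eq_withDensity_of_hasDerivAt_cdf (.mk fun A hA hA0 => ?_) ?_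
  · rw [hμ, map_choquet_apply hn ν hν0 hU hindep hA]
    refine Finset.sum_eq_zero fun σ _ => measure_mono_null Set.inter_subset_right
      (volume_baryPoint_preimage_eq_zero _ ?_ hA0)
    rw [cumul_zero hν0]
    exact hnd σ
  · have hknots : ∀ᵐ y : ℝ, ∀ (σ : Equiv.Perm (Fin n)) i, cumul ν σ i ≠ y :=
      ae_all_iff.2 fun σ => ae_all_iff.2 fun i =>
        (Measure.ae_ne volume (cumul ν σ i)).mono fun y hy => hy.symm
    filter_upwards [hknots] with y hy
    -- Nondegeneracy makes the formula valid at every `z`, including `0`, so it may be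
    -- differentiated as an identity of functions.
    have hF : ⇑(cdf μ) = fun z => 1 - (1 / (n.factorial : ℝ)) * ∑ σ : Equiv.Perm (Fin n),
        divDiff (fun x => truncPlus n (x - z)) n (cumul ν σ) := by
      funext z
      rw [cdf_eq_real, hplus z (Or.inr hnd)]
    rw [hF]
    refine (((HasDerivAt.fun_sum fun σ _ => hasDerivAt_divDiff_truncPlus hn (cumul ν σ)
      (hy σ)).const_mul (1 / (n.factorial : ℝ))).const_sub 1).congr_deriv ?_
    rw [Finset.sum_neg_distrib, mul_neg, neg_neg]
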